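/- A \emph{space} $A$ is a locale, given by its frame of opens $\mathcal{O}(A)$ (a complete lattice in which binary meets distribute over arbitrary joins). A \emph{nondeterministic and partial map} $f : A \to B$ is a map $f^* : \mathcal{O}(B) \to \mathcal{O}(A)$ that preserves all joins; spaces and these maps form the category $\mathbf{FSpc}_{nd,p}$. It has the following subcategories with the same objects: $\mathbf{FSpc}_{nd}$ (those $f$ for which $f^*$ preserves $\top$), $\mathbf{FSpc}_{p}$ (those $f$ for which $f^*$ preserves binary meets), and $\mathbf{FSpc}$ (those $f$ for which $f^*$ preserves $\top$ and binary meets, i.e. the continuous maps, so that $\mathbf{FSpc}$ is the category of locales). A continuous map $p : U \to A$ is \emph{open} if $p^*$ has a left adjoint $p_! : \mathcal{O}(U) \to \mathcal{O}(A)$ with $p_!(V \wedge p^*(W)) = p_!(V) \wedge W$ for all $V \in \mathcal{O}(U)$ and $W \in \mathcal{O}(A)$. It then has an inverse $p^{-1} : A \to U$ in $\mathbf{FSpc}_{nd,p}$, whose inverse image map is $p_!$. For a small family of spaces $(U_i)_{i \in I}$ let $\sum_{i} U_i$ be its coproduct in $\mathbf{FSpc}$, with injections $\mathsf{inj}_i$.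 The join $\bigsqcup_i f_i$ of a family of maps $f_i : A \to B$ in $\mathbf{FSpc}_{nd,p}$ is the map with $(\bigsqcup_i f_i)^*(W) = \bigvee_i f_i^*(W)$. For $\mathcal{C} \in \{\mathbf{FSpc}, \mathbf{FSpc}_{nd}, \mathbf{FSpc}_{p}, \mathbf{FSpc}_{nd,p}\}$, a \emph{pattern family for $\mathcal{C}$} is a small indexed family of open maps $(p_i : U_i \to A)_{i \in I}$ such that the map $\bigsqcup_{i \in I} \mathsf{inj}_i \circ p_i^{-1} : A \to \sum_{i \in I} U_i$ lies in $\mathcal{C}$. Let $\mathcal{J}_{\mathcal{C}}$ be the collection of pattern families for $\mathcal{C}$. \textbf{Theorem.} For each $\mathcal{C} \in \{\mathbf{FSpc}, \mathbf{FSpc}_{nd}, \mathbf{FSpc}_{p}, \mathbf{FSpc}_{nd,p}\}$, the collection $\mathcal{J}_{\mathcal{C}}$ is a Grothendieck pretopology on $\mathbf{FSpc}$, that is: \begin{enumerate} \item every family consisting of a single isomorphism $U \to A$ of $\mathbf{FSpc}$ is in $\mathcal{J}_{\mathcal{C}}$; \item if $(p_i : U_i \to A)_{i \in I}$ is in $\mathcal{J}_{\mathcal{C}}$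 and $f : V \to A$ is any continuous map, then the pullbacks of the $p_i$ along $f$ exist in $\mathbf{FSpc}$ and, for any choice of them, the family $(f^*U_i \to V)_{i \in I}$ is in $\mathcal{J}_{\mathcal{C}}$; \item if $(p_i : U_i \to A)_{i \in I}$ is in $\mathcal{J}_{\mathcal{C}}$ and, for each $i \in I$, $(p_{i,j} : U_{i,j} \to U_i)_{j \in J_i}$ is in $\mathcal{J}_{\mathcal{C}}$, then the family of composites $(p_i \circ p_{i,j} : U_{i,j} \to A)_{i \in I,\, j \in J_i}$ is in $\mathcal{J}_{\mathcal{C}}$. \end{enumerate} -/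

import Mathlib

open CategoryTheory CategoryTheory.Limits

universe v u w

/-! ### Spaces and continuous maps

A space is a locale (Mathlib's `Locale`, the opposite of the category of frames), its lattice of
opens is the underlying frame `(A : Type u)`, and a continuous map is a morphism of `Locale`. -/

/-- The inverse image map `f^*` from the opens of `B` to the opens of `A`. -/
def inverseImage {A B : Locale.{u}} (f : A ⟶ B) : FrameHom B A := f.unop.hom

/-- The continuous map with a given inverse image map. -/
def contMap {A B : Locale.{u}} (f : FrameHom B A) : A ⟶ B := (Frm.ofHom f).op

/-- A continuous map `f` is open if `f^*` has a left adjoint that satisfies the Frobenius law. -/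
def IsOpenLocaleMap {A B : Locale.{u}} (f : A ⟶ B) : Prop :=
  ∃ d : A → B, GaloisConnection d (inverseImage f) ∧
    ∀ (U : A) (V : B), d (U ⊓ inverseImage f V) = d U ⊓ V

/-- The direct image map `f_!` of an open map: the (unique) left adjoint of `f^*`. -/
noncomputable def directImage {A B : Locale.{u}} (f : A ⟶ B) (hf : IsOpenLocaleMap f) : A → B :=
  hf.choose

theorem gc_directImage {A B : Locale.{u}} (f : A ⟶ B) (hf : IsOpenLocaleMap f) :
    GaloisConnection (directImage f hf) (inverseImage f) :=
  hf.choose_spec.1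

/-! ### Sums of spaces -/

/-- The sum (disjoint union) of a family of spaces; an open of it is a family of opens. -/
def sumSpace {I : Type u} (U : I → Locale.{u}) : Locale.{u} := Locale.of (∀ i, U i)

/-- The projection from a product of frames onto a factor. -/
def projHom {I : Type u} (X : I → Type u) [∀ i, Order.Frame (X i)] (i : I) :
    FrameHom (∀ i, X i) (X i) where
  toFun W := W i
  map_inf' _ _ := rfl
  map_top' := rfl
  map_sSup' S := by rw [sSup_apply, sSup_image']

/-- The map into a product of frames with given components. -/
def tupleHom {I : Type u} {Y : Type u} [Order.Frame Y] (X : I → Type u) [∀ i, Order.Frame (X i)]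
    (h : ∀ i, FrameHom Y (X i)) : FrameHom Y (∀ i, X i) where
  toFun W := fun i => h i W
  map_inf' a b := funext fun i => map_inf (h i) a b
  map_top' := funext fun i => map_top (h i)
  map_sSup' S := funext fun i => by
    rw [map_sSup, sSup_apply_eq_sSup_image, Set.image_image]

/-- The injection of a summand; its inverse image map is the projection. -/
def sumInj {I : Type u} (U : I → Locale.{u}) (i : I) : U i ⟶ sumSpace U :=
  contMap (projHom (fun i => (U i : Type u)) i)

/-- The sum of a family of spaces, with its injections, is its coproduct in `Locale`. -/
def sumSpaceIsColimit {I : Type u} (U : I → Locale.{u}) :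
    IsColimit (Cofan.mk (sumSpace U) (sumInj U)) :=
  Cofan.IsColimit.mk _
    (fun s => contMap (tupleHom (fun i => (U i : Type u)) fun i => inverseImage (s.inj i)))
    (fun _ _ => rfl)
    (fun s m h => by
      apply Quiver.Hom.unop_inj
      apply Frm.hom_ext
      ext W
      funext i
      exact congrArg (fun g => inverseImage g W) (h i))

/-! ### Nondeterministic and partial maps -/

/-- The objects of the category `FSpc_{nd,p}`: spaces. -/
structure FSpcNDP : Type (u + 1) where
  space : Locale.{u}

/-- A nondeterministic and partial map from `A` to `B`: a join-preserving inverse image map from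
the opens of `B` to the opens of `A`. -/
@[ext]
structure FSpcNDP.Hom (A B : FSpcNDP.{u}) : Type u where
  inv : sSupHom B.space A.space

instance : Category.{u} FSpcNDP.{u} where
  Hom := FSpcNDP.Hom
  id A := ⟨sSupHom.id A.space⟩
  comp f g := ⟨f.inv.comp g.inv⟩

/-- Continuous maps, regarded as nondeterministic and partial maps. -/
def forgetNDP : Locale.{u} ⥤ FSpcNDP.{u} where
  obj A := ⟨A⟩
  map f := ⟨(inverseImage f : sSupHom _ _)⟩

/-- `FSpc_{nd,p}` as a (wide) subcategory of itself. -/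
def inFSpcNDP : MorphismProperty FSpcNDP.{u} := fun _ _ _ => True

/-- `FSpc_nd` as a (wide) subcategory of `FSpc_{nd,p}`: the inverse image map preserves `⊤`. -/
def inFSpcND : MorphismProperty FSpcNDP.{u} := fun _ _ f => f.inv ⊤ = ⊤

/-- `FSpc_p` as a (wide) subcategory of `FSpc_{nd,p}`: the inverse image map preserves binary
meets. -/
def inFSpcP : MorphismProperty FSpcNDP.{u} := fun _ _ f => ∀ U V, f.inv (U ⊓ V) = f.inv U ⊓ f.inv V

/-- `FSpc` as a (wide) subcategory of `FSpc_{nd,p}`: the inverse image map preserves `⊤` and binary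
meets. -/
def inFSpc : MorphismProperty FSpcNDP.{u} := fun _ _ f =>
  f.inv ⊤ = ⊤ ∧ ∀ U V, f.inv (U ⊓ V) = f.inv U ⊓ f.inv V

instance : (inFSpcNDP.{u}).IsMultiplicative where
  id_mem _ := trivial
  comp_mem _ _ _ _ := trivial

instance : (inFSpcND.{u}).IsMultiplicative where
  id_mem _ := rfl
  comp_mem f _ hf hg := (congrArg f.inv hg).trans hf

instance : (inFSpcP.{u}).IsMultiplicative where
  id_mem _ := fun _ _ => rfl
  comp_mem f _ hf hg := fun U V => (congrArg f.inv (hg U V)).trans (hf _ _)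

instance : (inFSpc.{u}).IsMultiplicative where
  id_mem _ := ⟨rfl, fun _ _ => rfl⟩
  comp_mem f _ hf hg :=
    ⟨(congrArg f.inv hg.1).trans hf.1, fun U V => (congrArg f.inv (hg.2 U V)).trans (hf.2 _ _)⟩

/-- The morphisms of the subcategory `FSpc` are exactly the continuous maps. -/
theorem inFSpc_iff {A B : Locale.{u}} (f : forgetNDP.obj A ⟶ forgetNDP.obj B) :
    inFSpc f ↔ ∃ g : A ⟶ B, forgetNDP.map g = f := by
  constructor
  · rintro ⟨h1, h2⟩
    exact ⟨contMap ⟨⟨⟨f.inv, h2⟩, h1⟩, f.inv.map_sSup'⟩, rfl⟩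
  · rintro ⟨g, rfl⟩
    exact ⟨(inverseImage g).map_top', (inverseImage g).map_inf'⟩

/-- The nondeterministic join of a family of maps: the join of the inverse image maps. -/
def ndJoin {I : Type w} {A B : FSpcNDP.{u}} (f : I → (A ⟶ B)) : A ⟶ B :=
  ⟨{ toFun := fun W => ⨆ i, (f i).inv W
     map_sSup' := fun S => by
       simp only [map_sSup, sSup_image]
       rw [iSup_comm]
       exact iSup_congr fun a => iSup_comm }⟩

/-- The partial and nondeterministic inverse `p⁻¹` of an open map `p`; its inverse image map is
the direct image map `p_!`. -/
noncomputable def openInverse {A B : Locale.{u}} (p : A ⟶ B) (hp : IsOpenLocaleMap p) :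
    forgetNDP.obj B ⟶ forgetNDP.obj A :=
  ⟨{ toFun := directImage p hp
     map_sSup' := fun S => by
       rw [sSup_image]
       exact (gc_directImage p hp).l_sSup }⟩

/-! ### Pattern families -/

/-- The map `⨆ i, inj_i ∘ p_i⁻¹` from `A` to the sum of the spaces `U i`. -/
noncomputable def patternInverse {A : Locale.{u}} {I : Type u} {U : I → Locale.{u}}
    (p : ∀ i, U i ⟶ A) (hp : ∀ i, IsOpenLocaleMap (p i)) :
    forgetNDP.obj A ⟶ forgetNDP.obj (sumSpace U) :=
  ndJoin fun i => openInverse (p i) (hp i) ≫ forgetNDP.map (sumInj U i)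

/-- A pattern family for the (wide) subcategory `C` of `FSpc_{nd,p}`: a family of open maps `p i`
such that `⨆ i, inj_i ∘ p_i⁻¹` lies in `C`. -/
def IsPatternFamily (C : MorphismProperty FSpcNDP.{u}) {A : Locale.{u}} {I : Type u}
    {U : I → Locale.{u}} (p : ∀ i, U i ⟶ A) : Prop :=
  ∃ hp : ∀ i, IsOpenLocaleMap (p i), C (patternInverse p hp)

/-! ### Grothendieck pretopologies -/

/-- A collection `J` of indexed families of morphisms with a common codomain is a Grothendieck
pretopology: isomorphisms cover; pullbacks of covering families exist and are covering families
(for every choice of the pullbacks); composites of covering families are covering families. -/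
structure IsGrothendieckPretopology {S : Type u} [Category.{v} S]
    (J : ∀ {A : S} {I : Type w} {U : I → S}, (∀ i, U i ⟶ A) → Prop) : Prop where
  iso_covers : ∀ {A : S} {I : Type w} [Unique I] {U : I → S} (p : ∀ i, U i ⟶ A),
    (∀ i, IsIso (p i)) → J p
  hasPullback : ∀ {A : S} {I : Type w} {U : I → S} (p : ∀ i, U i ⟶ A), J p →
    ∀ {V : S} (f : V ⟶ A) (i : I), HasPullback (p i) f
  stable : ∀ {A : S} {I : Type w} {U : I → S} (p : ∀ i, U i ⟶ A), J p →
    ∀ {V : S} (f : V ⟶ A) {W : I → S} (g : ∀ i, W i ⟶ U i) (q : ∀ i, W i ⟶ V),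
      (∀ i, IsPullback (g i) (q i) (p i) f) → J q
  transitive : ∀ {A : S} {I : Type w} {U : I → S} (p : ∀ i, U i ⟶ A), J p →
    ∀ {K : I → Type w} {W : ∀ i, K i → S} (q : ∀ i (k : K i), W i k ⟶ U i),
      (∀ i, J (q i)) → J (fun x : (i : I) × K i => q x.1 x.2 ≫ p x.1)

/-!
For an open map `p` write `p_!` for its direct image map. The inverse image map of
`⨆ i, inj_i ∘ p_i⁻¹` sends a family `(W i)` of opens to `⨆ i, (p_i)_! (W i)`. It preserves `⊤` if
and only if `⨆ i, (p_i)_! ⊤ = ⊤`, and it preserves binary meets if and only if each `(p_i)_!` does and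
`(p_i)_! ⊤ ⊓ (p_j)_! ⊤ = ⊥` for `i ≠ j` (`inFSpcP_patternInverse_iff`, by testing on families
supported at one index). These conditions clearly hold for isomorphisms, and they pass to composites
because `(p ∘ q)_! = p_! ∘ q_!`.

The substance is stability under pullback along `f : V ⟶ A`. The pullback of locales is built as a
pushout of frames, namely the sublocale of saturated sets in the frame of lower sets of `U × V`
(`FramePushout.pushout`); this gives its existence and the fact that every open of it is a join of
rectangles `g^* u ⊓ q^* v` (`IsPullback.eq_sSup_rectangles`). When `p` is open, the Frobenius law
makes `{(u, v) | v ⊓ f^* (p_! u) ≤ x}` saturated, so a rectangle lies below `q^* x` exactly if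
`v ⊓ f^* (p_! u) ≤ x` (`IsPullback.rectangle_le_iff`). Hence `q` is open, with
`q_! (g^* u ⊓ q^* v) = v ⊓ f^* (p_! u)`. Rectangles are closed under meets and every open is a join
of them, so this formula carries each of the conditions above from `p` to `q`.
-/

/-! ### Pushouts of frames -/

namespace FramePushout

section

variable {A B D : Type u} [Order.Frame A] [Order.Frame B] [Order.Frame D]

/-- A set of pairs is saturated over `φ : A → B` and `ψ : A → D` if it is closed under joins in
each coordinate and is balanced: an element of `A` may be moved from one coordinate to the other.
A pair `(b, d)` stands for the element `b ⊗ d` of the pushout. -/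
structure IsSaturated (φ : FrameHom A B) (ψ : FrameHom A D) (S : LowerSet (B × D)) : Prop where
  left : ∀ (s : Set B) (d : D), (∀ b ∈ s, (b, d) ∈ S) → (sSup s, d) ∈ S
  right : ∀ (b : B) (s : Set D), (∀ d ∈ s, (b, d) ∈ S) → (b, sSup s) ∈ S
  balanced : ∀ (a : A) (b : B) (d : D), (b ⊓ φ a, d) ∈ S ↔ (b, d ⊓ ψ a) ∈ S

theorem mem_himp_iff {X : Type*} [SemilatticeInf X] {S T : LowerSet X} {x : X} :
    x ∈ S ⇨ T ↔ ∀ y ≤ x, y ∈ S → y ∈ T := by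
  rw [← LowerSet.Iic_le, le_himp_iff]
  exact ⟨fun h y hy hS => h ⟨hy, hS⟩, fun h y hy => h y hy.1 hy.2⟩

/-- The pushout of `φ : A → B` and `ψ : A → D`, as the sublocale of saturated sets in the frame
of lower sets of `B × D`. -/
def pushout (φ : FrameHom A B) (ψ : FrameHom A D) : Sublocale (LowerSet (B × D)) where
  carrier := {S | IsSaturated φ ψ S}
  sInf_mem' 𝒮 h𝒮 := by
    refine ⟨fun s d h => ?_, fun b s h => ?_, fun a b d => ?_⟩ <;>
      simp only [LowerSet.mem_sInf_iff] at *
    · exact fun S hS => (h𝒮 hS).left s d fun b hb => h b hb S hS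
    · exact fun S hS => (h𝒮 hS).right b s fun d hd => h d hd S hS
    · exact forall₂_congr fun S hS => (h𝒮 hS).balanced a b d
  himp_mem' S T hT := by
    refine ⟨fun s d h => ?_, fun b s h => ?_, fun a b d => ?_⟩ <;>
      simp only [mem_himp_iff] at *
    -- A pair `(y, e)` of `S` below `(sSup s, d)` is the join of the `(y ⊓ b, e)` with `b ∈ s`, which
    -- lie in `S` and below `(b, d)`, hence in `T`. The other two conditions are similar.
    · rintro ⟨y, e⟩ ⟨hy, he⟩ hS
      have hy : y ≤ sSup s := hy
      have key := hT.left ((fun b => y ⊓ b) '' s) e (by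
        rintro _ ⟨b, hb, rfl⟩
        exact h b hb _ ⟨inf_le_right, he⟩
          (S.lower (a := (y, e)) (Prod.mk_le_mk.2 ⟨inf_le_left, le_rfl⟩) hS))
      rwa [sSup_image, ← inf_sSup_eq, inf_eq_left.2 hy] at key
    · rintro ⟨y, e⟩ ⟨hy, he⟩ hS
      have he : e ≤ sSup s := he
      have key := hT.right y ((fun d => e ⊓ d) '' s) (by
        rintro _ ⟨d, hd, rfl⟩
        exact h d hd _ ⟨hy, inf_le_right⟩
          (S.lower (a := (y, e)) (Prod.mk_le_mk.2 ⟨le_rfl, inf_le_left⟩) hS))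
      rwa [sSup_image, ← inf_sSup_eq, inf_eq_left.2 he] at key
    · constructor
      · rintro h ⟨y, e⟩ ⟨hy, he⟩ hS
        obtain ⟨he, hea⟩ := le_inf_iff.1 (show e ≤ d ⊓ ψ a from he)
        have key := (hT.balanced a y e).1 (h _ ⟨inf_le_inf_right _ hy, he⟩
          (S.lower (a := (y, e)) (Prod.mk_le_mk.2 ⟨inf_le_left, le_rfl⟩) hS))
        rwa [inf_eq_left.2 hea] at key
      · rintro h ⟨y, e⟩ ⟨hy, he⟩ hS
        obtain ⟨hy, hya⟩ := le_inf_iff.1 (show y ≤ b ⊓ φ a from hy)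
        have key := (hT.balanced a y e).2 (h _ ⟨hy, inf_le_inf_right _ he⟩
          (S.lower (a := (y, e)) (Prod.mk_le_mk.2 ⟨le_rfl, inf_le_left⟩) hS))
        rwa [inf_eq_left.2 hya] at key

variable (φ : FrameHom A B) (ψ : FrameHom A D)

/-- The element `b ⊗ d` of the pushout: the least saturated set that contains `(b, d)`. -/
def tensor (b : B) (d : D) : pushout φ ψ := (pushout φ ψ).restrict (LowerSet.Iic (b, d))

variable {φ ψ}

theorem tensor_le_iff {b : B} {d : D} {S : pushout φ ψ} : tensor φ ψ b d ≤ S ↔ (b, d) ∈ S.1 :=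
  ((pushout φ ψ).giRestrict.gc _ _).trans LowerSet.Iic_le

theorem tensor_inf (b b' : B) (d d' : D) :
    tensor φ ψ (b ⊓ b') (d ⊓ d') = tensor φ ψ b d ⊓ tensor φ ψ b' d' := by
  rw [tensor, tensor, tensor, ← map_inf, ← LowerSet.Iic_inf]
  rfl

theorem tensor_top : tensor φ ψ ⊤ ⊤ = ⊤ :=
  top_unique fun _ _ => tensor_le_iff.1 le_rfl |> (tensor φ ψ ⊤ ⊤).1.lower ⟨le_top, le_top⟩

theorem tensor_mono {b b' : B} {d d' : D} (hb : b ≤ b') (hd : d ≤ d') :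
    tensor φ ψ b d ≤ tensor φ ψ b' d' :=
  tensor_le_iff.2 ((tensor φ ψ b' d').1.lower (Prod.mk_le_mk.2 ⟨hb, hd⟩) (tensor_le_iff.1 le_rfl))

theorem sSup_tensor (s : Set B) (d : D) :
    tensor φ ψ (sSup s) d = sSup ((fun b => tensor φ ψ b d) '' s) := by
  apply le_antisymm
  · exact tensor_le_iff.2 ((sSup _ : pushout φ ψ).2.left s d fun b hb =>
      tensor_le_iff.1 (le_sSup ⟨b, hb, rfl⟩))
  · refine sSup_le ?_
    rintro _ ⟨b, hb, rfl⟩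
    exact tensor_mono (le_sSup hb) le_rfl

theorem tensor_sSup (b : B) (s : Set D) :
    tensor φ ψ b (sSup s) = sSup (tensor φ ψ b '' s) := by
  apply le_antisymm
  · exact tensor_le_iff.2 ((sSup _ : pushout φ ψ).2.right b s fun d hd =>
      tensor_le_iff.1 (le_sSup ⟨d, hd, rfl⟩))
  · refine sSup_le ?_
    rintro _ ⟨d, hd, rfl⟩
    exact tensor_mono le_rfl (le_sSup hd)

variable (φ ψ)

/-- The coprojection `b ↦ b ⊗ ⊤`. -/
def inl : FrameHom B (pushout φ ψ) where
  toFun b := tensor φ ψ b ⊤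
  map_inf' b b' := by rw [← tensor_inf, inf_idem]
  map_top' := tensor_top
  map_sSup' s := sSup_tensor s ⊤

/-- The coprojection `d ↦ ⊤ ⊗ d`. -/
def inr : FrameHom D (pushout φ ψ) where
  toFun d := tensor φ ψ ⊤ d
  map_inf' d d' := by rw [← tensor_inf, inf_idem]
  map_top' := tensor_top
  map_sSup' s := tensor_sSup ⊤ s

variable {φ ψ}

theorem inl_inf_inr (b : B) (d : D) : inl φ ψ b ⊓ inr φ ψ d = tensor φ ψ b d := by
  change tensor φ ψ b ⊤ ⊓ tensor φ ψ ⊤ d = _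
  rw [← tensor_inf, inf_top_eq, top_inf_eq]

theorem inl_comp_eq_inr_comp (a : A) : inl φ ψ (φ a) = inr φ ψ (ψ a) := by
  apply le_antisymm
  · refine tensor_le_iff.2 ?_
    have key := ((inr φ ψ (ψ a)).2.balanced a ⊤ ⊤).2
    rw [top_inf_eq, top_inf_eq] at key
    exact key (tensor_le_iff.1 le_rfl)
  · refine tensor_le_iff.2 ?_
    have key := ((inl φ ψ (φ a)).2.balanced a ⊤ ⊤).1
    rw [top_inf_eq, top_inf_eq] at key
    exact key (tensor_le_iff.1 le_rfl)

/-- Every element of the pushout is the join of the elements `b ⊗ d` below it. -/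
theorem eq_sSup_tensor (S : pushout φ ψ) :
    S = sSup ((fun x : B × D => inl φ ψ x.1 ⊓ inr φ ψ x.2) '' (S.1 : Set (B × D))) := by
  apply le_antisymm
  · intro x hx
    exact tensor_le_iff.1 ((inl_inf_inr x.1 x.2).ge.trans (le_sSup ⟨x, hx, rfl⟩))
  · refine sSup_le ?_
    rintro _ ⟨x, hx, rfl⟩
    exact (inl_inf_inr x.1 x.2).trans_le (tensor_le_iff.2 hx)

end

section

variable {A B D X : Type u} [Order.Frame A] [Order.Frame B] [Order.Frame D] [Order.Frame X]
  {φ : FrameHom A B} {ψ : FrameHom A D} (h : FrameHom B X) (k : FrameHom D X)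

/-- The set of pairs `(b, d)` such that `h b ⊓ k d ≤ x`. -/
def below (w : ∀ a, h (φ a) = k (ψ a)) (x : X) : pushout φ ψ where
  val :=
    { carrier := {y | h y.1 ⊓ k y.2 ≤ x}
      lower' := fun _ _ hy hx =>
        (inf_le_inf (OrderHomClass.mono h hy.1) (OrderHomClass.mono k hy.2)).trans hx }
  property := by
    refine ⟨fun s d H => ?_, fun b s H => ?_, fun a b d => ?_⟩
    · change h (sSup s) ⊓ k d ≤ x
      rw [map_sSup, sSup_image, iSup₂_inf_eq]
      exact iSup₂_le H
    · change h b ⊓ k (sSup s) ≤ x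
      rw [map_sSup, sSup_image, inf_iSup₂_eq]
      exact iSup₂_le H
    · change h (b ⊓ φ a) ⊓ k d ≤ x ↔ h b ⊓ k (d ⊓ ψ a) ≤ x
      rw [map_inf, map_inf, w, inf_assoc, inf_comm (k d)]

/-- The map out of the pushout induced by a cocone, `b ⊗ d ↦ h b ⊓ k d`. It preserves joins because
it is left adjoint to `below`. -/
def desc (w : ∀ a, h (φ a) = k (ψ a)) : FrameHom (pushout φ ψ) X :=
  have gc : GaloisConnection
      (fun S : pushout φ ψ => ⨆ y ∈ S.1, h y.1 ⊓ k y.2) (below h k w) :=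
    fun _ _ => iSup₂_le_iff
  { toFun := fun S => ⨆ y ∈ S.1, h y.1 ⊓ k y.2
    map_inf' := fun S T => by
      refine le_antisymm (le_inf (gc.monotone_l inf_le_left) (gc.monotone_l inf_le_right)) ?_
      simp only [iSup_inf_eq, inf_iSup_eq]
      refine iSup₂_le fun z hz => iSup₂_le fun y hy => ?_
      have hmem : y ⊓ z ∈ (S ⊓ T).1 :=
        ⟨S.1.lower (inf_le_left : y ⊓ z ≤ y) hy, T.1.lower (inf_le_right : y ⊓ z ≤ z) hz⟩
      refine le_trans ?_ (le_iSup₂_of_le (y ⊓ z) hmem le_rfl)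
      rw [Prod.fst_inf, Prod.snd_inf, map_inf, map_inf]
      exact (inf_inf_inf_comm _ _ _ _).le
    map_top' := top_unique (le_iSup₂_of_le (⊤ : B × D) trivial (by
      rw [Prod.fst_top, Prod.snd_top, map_top, map_top, inf_top_eq]))
    map_sSup' := fun 𝒮 => by rw [sSup_image]; exact gc.l_sSup }

theorem desc_le_iff (w : ∀ a, h (φ a) = k (ψ a)) (S : pushout φ ψ) (x : X) :
    desc h k w S ≤ x ↔ S ≤ below h k w x :=
  iSup₂_le_iff

theorem desc_tensor (w : ∀ a, h (φ a) = k (ψ a)) (b : B) (d : D) :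
    desc h k w (tensor φ ψ b d) = h b ⊓ k d :=
  eq_of_forall_ge_iff fun x => (desc_le_iff h k w _ x).trans tensor_le_iff

theorem desc_inl (w : ∀ a, h (φ a) = k (ψ a)) (b : B) : desc h k w (inl φ ψ b) = h b :=
  (desc_tensor h k w b ⊤).trans (by rw [map_top, inf_top_eq])

theorem desc_inr (w : ∀ a, h (φ a) = k (ψ a)) (d : D) : desc h k w (inr φ ψ d) = k d :=
  (desc_tensor h k w ⊤ d).trans (by rw [map_top, top_inf_eq])

variable {h k} in
theorem hom_ext {m n : FrameHom (pushout φ ψ) X} (hl : ∀ b, m (inl φ ψ b) = n (inl φ ψ b))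
    (hr : ∀ d, m (inr φ ψ d) = n (inr φ ψ d)) : m = n := by
  ext S
  rw [eq_sSup_tensor S, map_sSup, map_sSup, Set.image_image, Set.image_image]
  simp only [map_inf, hl, hr]

end

/-- For a map `φ` with a left adjoint `l` satisfying the Frobenius law, the pairs `(b, d)` such that
`d ⊓ ψ (l b) ≤ x` form a saturated set that contains `(⊤, x)`, hence every pair `(b, d)` with
`b ⊗ d ≤ ⊤ ⊗ x`. -/
theorem inf_le_of_tensor_le_inr {A B D : Type u} [Order.Frame A] [Order.Frame B] [Order.Frame D]
    {φ : FrameHom A B} {ψ : FrameHom A D} {l : B → A} (gc : GaloisConnection l φ)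
    (frob : ∀ b a, l (b ⊓ φ a) = l b ⊓ a) {b : B} {d x : D}
    (H : inl φ ψ b ⊓ inr φ ψ d ≤ inr φ ψ x) : d ⊓ ψ (l b) ≤ x := by
  let R : LowerSet (B × D) :=
    { carrier := {y | y.2 ⊓ ψ (l y.1) ≤ x}
      lower' := fun _ _ hy hx =>
        (inf_le_inf hy.2 (OrderHomClass.mono ψ (gc.monotone_l hy.1))).trans hx }
  have hR : IsSaturated φ ψ R := by
    refine ⟨fun s e h => ?_, fun c s h => ?_, fun a c e => ?_⟩
    · change e ⊓ ψ (l (sSup s)) ≤ x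
      rw [gc.l_sSup, map_iSup, inf_iSup_eq]
      simp only [map_iSup, inf_iSup_eq]
      exact iSup₂_le h
    · change sSup s ⊓ ψ (l c) ≤ x
      rw [sSup_inf_eq]
      exact iSup₂_le h
    · change e ⊓ ψ (l (c ⊓ φ a)) ≤ x ↔ e ⊓ ψ a ⊓ ψ (l c) ≤ x
      rw [frob, map_inf, inf_comm (ψ (l c)), inf_assoc]
  have hx : inr φ ψ x ≤ (⟨R, hR⟩ : pushout φ ψ) :=
    tensor_le_iff.2 (show x ⊓ ψ (l ⊤) ≤ x from inf_le_left)
  exact tensor_le_iff.1 ((inl_inf_inr b d).ge.trans (H.trans hx))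

end FramePushout

/-! ### Pullbacks of locales -/

open FramePushout in
/-- The pullback of two continuous maps is the pushout of their inverse image maps. -/
theorem isPullback_pushout {A U V : Locale.{u}} (p : U ⟶ A) (f : V ⟶ A) :
    IsPullback
      (contMap (inl (inverseImage p) (inverseImage f)) :
        Locale.of (pushout (inverseImage p) (inverseImage f)) ⟶ U)
      (contMap (inr (inverseImage p) (inverseImage f)) :
        Locale.of (pushout (inverseImage p) (inverseImage f)) ⟶ V) p f := by
  have w : ∀ s : PullbackCone p f, ∀ a,
      inverseImage s.fst (inverseImage p a) = inverseImage s.snd (inverseImage f a) :=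
    fun s a => congrArg (fun g => inverseImage g a) s.condition
  refine ⟨⟨?_⟩, ⟨PullbackCone.IsLimit.mk _
    (fun s => contMap (desc (inverseImage s.fst) (inverseImage s.snd) (w s))) ?_ ?_ ?_⟩⟩
  · apply Quiver.Hom.unop_inj
    apply Frm.hom_ext
    ext a
    exact inl_comp_eq_inr_comp a
  · intro s
    apply Quiver.Hom.unop_inj
    apply Frm.hom_ext
    ext b
    exact desc_inl _ _ (w s) b
  · intro s
    apply Quiver.Hom.unop_inj
    apply Frm.hom_ext
    ext d
    exact desc_inr _ _ (w s) d
  · intro s m hl hr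
    apply Quiver.Hom.unop_inj
    apply Frm.hom_ext
    refine hom_ext (fun b => ?_) fun d => ?_
    · exact (congrArg (fun g => inverseImage g b) hl).trans (desc_inl _ _ (w s) b).symm
    · exact (congrArg (fun g => inverseImage g d) hr).trans (desc_inr _ _ (w s) d).symm

theorem hasPullback_locale {A U V : Locale.{u}} (p : U ⟶ A) (f : V ⟶ A) : HasPullback p f :=
  (isPullback_pushout p f).hasPullback

theorem inverseImage_hom_inv {A B : Locale.{u}} (e : A ≅ B) (x : A) :
    inverseImage e.hom (inverseImage e.inv x) = x :=
  congrArg (fun g => inverseImage g x) e.hom_inv_id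

theorem inverseImage_inv_hom {A B : Locale.{u}} (e : A ≅ B) (x : B) :
    inverseImage e.inv (inverseImage e.hom x) = x :=
  congrArg (fun g => inverseImage g x) e.inv_hom_id

theorem inverseImage_mono {A B : Locale.{u}} (f : A ⟶ B) : Monotone (inverseImage f) :=
  OrderHomClass.mono _

/-- In a pullback, every open is a join of rectangles `g^* u ⊓ q^* v`. -/
theorem CategoryTheory.IsPullback.eq_sSup_rectangles {A U V W : Locale.{u}} {g : W ⟶ U}
    {q : W ⟶ V} {p : U ⟶ A} {f : V ⟶ A} (sq : IsPullback g q p f) (x : W) :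
    ∃ S : Set (U × V),
      x = sSup ((fun y => inverseImage g y.1 ⊓ inverseImage q y.2) '' S) := by
  have sq' := isPullback_pushout p f
  let e := sq.isoIsPullback _ _ sq'
  have hg : ∀ b, inverseImage e.hom (FramePushout.inl _ _ b) = inverseImage g b := fun b =>
    congrArg (fun m => inverseImage m b) (sq.isoIsPullback_hom_fst _ _ sq')
  have hq : ∀ d, inverseImage e.hom (FramePushout.inr _ _ d) = inverseImage q d := fun d =>
    congrArg (fun m => inverseImage m d) (sq.isoIsPullback_hom_snd _ _ sq')
  have key := congrArg (inverseImage e.hom) (FramePushout.eq_sSup_tensor (inverseImage e.inv x))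
  let S : FramePushout.pushout (inverseImage p) (inverseImage f) := inverseImage e.inv x
  refine ⟨(S.1 : Set (U × V)), (inverseImage_hom_inv e x).symm.trans (key.trans ?_)⟩
  refine ((inverseImage e.hom).map_sSup' _).trans (congrArg sSup ?_)
  refine (Set.image_image _ _ _).trans (Set.image_congr fun y _ => ?_)
  exact ((inverseImage e.hom).map_inf' _ _).trans (congrArg₂ (· ⊓ ·) (hg _) (hq _))

/-! ### Open maps -/

theorem directImage_frobenius {A B : Locale.{u}} (f : A ⟶ B) (hf : IsOpenLocaleMap f)
    (x : A) (y : B) : directImage f hf (x ⊓ inverseImage f y) = directImage f hf x ⊓ y :=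
  hf.choose_spec.2 x y

theorem directImage_mono {A B : Locale.{u}} (f : A ⟶ B) (hf : IsOpenLocaleMap f) :
    Monotone (directImage f hf) :=
  (gc_directImage f hf).monotone_l

theorem directImage_bot {A B : Locale.{u}} (f : A ⟶ B) (hf : IsOpenLocaleMap f) :
    directImage f hf ⊥ = ⊥ :=
  (gc_directImage f hf).l_bot

theorem directImage_eq {A B : Locale.{u}} {f : A ⟶ B} (hf : IsOpenLocaleMap f) {d : A → B}
    (gc : GaloisConnection d (inverseImage f)) : directImage f hf = d :=
  funext fun _ => (gc_directImage f hf).l_unique gc fun _ => rfl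

theorem gc_inverseImage_inv {A B : Locale.{u}} (e : A ≅ B) :
    GaloisConnection (inverseImage e.inv) (inverseImage e.hom) := fun x y =>
  ⟨fun h => (inverseImage_hom_inv e x).ge.trans (inverseImage_mono e.hom h),
    fun h => (inverseImage_mono e.inv h).trans (inverseImage_inv_hom e y).le⟩

theorem isOpenLocaleMap_iso_hom {A B : Locale.{u}} (e : A ≅ B) : IsOpenLocaleMap e.hom :=
  ⟨_, gc_inverseImage_inv e, fun _ _ =>
    (map_inf (inverseImage e.inv) _ _).trans (congrArg _ (inverseImage_inv_hom e _))⟩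

theorem directImage_iso_hom {A B : Locale.{u}} (e : A ≅ B) (h : IsOpenLocaleMap e.hom) :
    directImage e.hom h = inverseImage e.inv :=
  directImage_eq h (gc_inverseImage_inv e)

theorem isOpenLocaleMap_of_isIso {A B : Locale.{u}} (f : A ⟶ B) [IsIso f] : IsOpenLocaleMap f :=
  isOpenLocaleMap_iso_hom (asIso f)

theorem directImage_of_isIso {A B : Locale.{u}} (f : A ⟶ B) [IsIso f] (hf : IsOpenLocaleMap f) :
    directImage f hf = inverseImage (inv f) :=
  directImage_iso_hom (asIso f) hf

theorem gc_directImage_comp {A B D : Locale.{u}} {f : A ⟶ B} {g : B ⟶ D}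
    (hf : IsOpenLocaleMap f) (hg : IsOpenLocaleMap g) :
    GaloisConnection (directImage g hg ∘ directImage f hf) (inverseImage (f ≫ g)) :=
  (gc_directImage f hf).compose (gc_directImage g hg)

theorem IsOpenLocaleMap.comp {A B D : Locale.{u}} {f : A ⟶ B} {g : B ⟶ D}
    (hf : IsOpenLocaleMap f) (hg : IsOpenLocaleMap g) : IsOpenLocaleMap (f ≫ g) :=
  ⟨_, gc_directImage_comp hf hg, fun x y =>
    (congrArg (directImage g hg) (directImage_frobenius f hf x (inverseImage g y))).trans
      (directImage_frobenius g hg _ y)⟩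

theorem directImage_comp {A B D : Locale.{u}} {f : A ⟶ B} {g : B ⟶ D} (hf : IsOpenLocaleMap f)
    (hg : IsOpenLocaleMap g) (h : IsOpenLocaleMap (f ≫ g)) (x : A) :
    directImage (f ≫ g) h x = directImage g hg (directImage f hf x) :=
  congrFun (directImage_eq h (gc_directImage_comp hf hg)) x

/-- For `p` open, `v ⊓ f^* (p_! u)` is universal among the opens `x` such that the rectangle
`g^* u ⊓ q^* v` of the pullback lies below `q^* x`, so it is what `q_!` has to be on rectangles. -/
theorem CategoryTheory.IsPullback.rectangle_le_iff {A U V W : Locale.{u}} {g : W ⟶ U}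
    {q : W ⟶ V} {p : U ⟶ A} {f : V ⟶ A} (sq : IsPullback g q p f) (hp : IsOpenLocaleMap p)
    {u : U} {v x : V} :
    inverseImage g u ⊓ inverseImage q v ≤ inverseImage q x ↔
      v ⊓ inverseImage f (directImage p hp u) ≤ x := by
  constructor
  · intro H
    have sq' := isPullback_pushout p f
    let e := sq.isoIsPullback _ _ sq'
    have hg : ∀ b, inverseImage e.inv (inverseImage g b) = FramePushout.inl _ _ b := fun b =>
      congrArg (fun m => inverseImage m b) (sq.isoIsPullback_inv_fst _ _ sq')
    have hq : ∀ d, inverseImage e.inv (inverseImage q d) = FramePushout.inr _ _ d := fun d =>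
      congrArg (fun m => inverseImage m d) (sq.isoIsPullback_inv_snd _ _ sq')
    have H' := inverseImage_mono e.inv H
    rw [map_inf, hg, hq, hq] at H'
    exact FramePushout.inf_le_of_tensor_le_inr (gc_directImage p hp)
      (directImage_frobenius p hp) H'
  · intro H
    have hw : inverseImage g (inverseImage p (directImage p hp u)) =
        inverseImage q (inverseImage f (directImage p hp u)) :=
      congrArg (fun m => inverseImage m (directImage p hp u)) sq.w
    calc inverseImage g u ⊓ inverseImage q v
        ≤ inverseImage q (inverseImage f (directImage p hp u)) ⊓ inverseImage q v :=
          inf_le_inf_right _ ((inverseImage_mono g ((gc_directImage p hp).le_u_l u)).trans hw.le)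
      _ = inverseImage q (v ⊓ inverseImage f (directImage p hp u)) := by rw [map_inf, inf_comm]
      _ ≤ inverseImage q x := inverseImage_mono q H

/-- Open maps are stable under pullback. The direct image of an open `x` is the join of the values
`v ⊓ f^* (p_! u)` over the rectangles `g^* u ⊓ q^* v` below `x`. -/
theorem IsOpenLocaleMap.of_isPullback {A U V W : Locale.{u}} {g : W ⟶ U} {q : W ⟶ V} {p : U ⟶ A}
    {f : V ⟶ A} (sq : IsPullback g q p f) (hp : IsOpenLocaleMap p) : IsOpenLocaleMap q := by
  let L : W → V := fun x => ⨆ y ∈ {y : U × V | inverseImage g y.1 ⊓ inverseImage q y.2 ≤ x},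
    y.2 ⊓ inverseImage f (directImage p hp y.1)
  have gc : GaloisConnection L (inverseImage q) := by
    intro x z
    refine iSup₂_le_iff.trans ⟨fun h => ?_, fun h y hy =>
      (sq.rectangle_le_iff hp).1 (le_trans hy h)⟩
    obtain ⟨S, hS⟩ := sq.eq_sSup_rectangles x
    rw [hS]
    refine sSup_le ?_
    rintro _ ⟨y, hy, rfl⟩
    refine (sq.rectangle_le_iff hp).2 (h y ?_)
    change inverseImage g y.1 ⊓ inverseImage q y.2 ≤ x
    rw [hS]
    exact le_sSup ⟨y, hy, rfl⟩
  refine ⟨L, gc, fun x z => le_antisymm ?_ ?_⟩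
  · exact le_inf (gc.monotone_l inf_le_left) ((gc.monotone_l inf_le_right).trans (gc.l_u_le z))
  · simp only [L, iSup_inf_eq]
    refine iSup₂_le fun y hy => ?_
    refine le_iSup₂_of_le (y.1, y.2 ⊓ z) ?_ (inf_right_comm _ _ _).le
    change inverseImage g y.1 ⊓ inverseImage q (y.2 ⊓ z) ≤ _
    rw [map_inf, ← inf_assoc]
    exact inf_le_inf_right _ hy

/-- The Beck–Chevalley formula, combined with the Frobenius law. -/
theorem directImage_rectangle {A U V W : Locale.{u}} {g : W ⟶ U} {q : W ⟶ V} {p : U ⟶ A}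
    {f : V ⟶ A} (sq : IsPullback g q p f) (hp : IsOpenLocaleMap p) (hq : IsOpenLocaleMap q)
    (u : U) (v : V) :
    directImage q hq (inverseImage g u ⊓ inverseImage q v) =
      v ⊓ inverseImage f (directImage p hp u) :=
  eq_of_forall_ge_iff fun x => (gc_directImage q hq _ x).trans (sq.rectangle_le_iff hp)

theorem directImage_top_of_isPullback {A U V W : Locale.{u}} {g : W ⟶ U} {q : W ⟶ V} {p : U ⟶ A}
    {f : V ⟶ A} (sq : IsPullback g q p f) (hp : IsOpenLocaleMap p) (hq : IsOpenLocaleMap q) :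
    directImage q hq ⊤ = inverseImage f (directImage p hp ⊤) := by
  have key := directImage_rectangle sq hp hq ⊤ ⊤
  rwa [map_top, map_top, inf_top_eq, top_inf_eq] at key

/-- If the direct image map of an open map preserves binary meets, then so does that of each of its
pullbacks: by distributivity it is enough to compare the meets of rectangles. -/
theorem directImage_inf_le_of_isPullback {A U V W : Locale.{u}} {g : W ⟶ U} {q : W ⟶ V}
    {p : U ⟶ A} {f : V ⟶ A} (sq : IsPullback g q p f) (hp : IsOpenLocaleMap p)
    (hq : IsOpenLocaleMap q)
    (H : ∀ x y, directImage p hp x ⊓ directImage p hp y ≤ directImage p hp (x ⊓ y)) (x y : W) :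
    directImage q hq x ⊓ directImage q hq y ≤ directImage q hq (x ⊓ y) := by
  obtain ⟨S, hS⟩ := sq.eq_sSup_rectangles x
  obtain ⟨T, hT⟩ := sq.eq_sSup_rectangles y
  have hx : directImage q hq x = ⨆ s ∈ S, s.2 ⊓ inverseImage f (directImage p hp s.1) := by
    rw [hS, (gc_directImage q hq).l_sSup, iSup_image]
    simp only [directImage_rectangle sq hp hq]
  have hy : directImage q hq y = ⨆ t ∈ T, t.2 ⊓ inverseImage f (directImage p hp t.1) := by
    rw [hT, (gc_directImage q hq).l_sSup, iSup_image]
    simp only [directImage_rectangle sq hp hq]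
  rw [hx, hy]
  simp only [iSup_inf_eq, inf_iSup_eq]
  refine iSup₂_le fun t ht => iSup₂_le fun s hs => ?_
  calc s.2 ⊓ inverseImage f (directImage p hp s.1) ⊓
        (t.2 ⊓ inverseImage f (directImage p hp t.1))
      = s.2 ⊓ t.2 ⊓ inverseImage f (directImage p hp s.1 ⊓ directImage p hp t.1) := by
        rw [map_inf, inf_inf_inf_comm]
    _ ≤ s.2 ⊓ t.2 ⊓ inverseImage f (directImage p hp (s.1 ⊓ t.1)) :=
        inf_le_inf_left _ (inverseImage_mono f (H _ _))
    _ = directImage q hq (inverseImage g (s.1 ⊓ t.1) ⊓ inverseImage q (s.2 ⊓ t.2)) :=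
        (directImage_rectangle sq hp hq _ _).symm
    _ ≤ directImage q hq (x ⊓ y) := by
        apply directImage_mono
        rw [map_inf, map_inf, inf_inf_inf_comm]
        refine inf_le_inf ?_ ?_
        · rw [hS]; exact le_sSup ⟨s, hs, rfl⟩
        · rw [hT]; exact le_sSup ⟨t, ht, rfl⟩

/-! ### Pattern families -/

section PatternFamilies

variable {A : Locale.{u}} {I : Type u} {U : I → Locale.{u}} {p : ∀ i, U i ⟶ A}

theorem inFSpcND_patternInverse_iff (hp : ∀ i, IsOpenLocaleMap (p i)) :
    inFSpcND (patternInverse p hp) ↔ ⨆ i, directImage (p i) (hp i) ⊤ = ⊤ :=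
  Iff.rfl

open Classical in
/-- The map `⨆ i, inj_i ∘ p_i⁻¹` is a partial map if and only if each `(p i)_!` preserves binary
meets and distinct `p i` have disjoint images. -/
theorem inFSpcP_patternInverse_iff (hp : ∀ i, IsOpenLocaleMap (p i)) :
    inFSpcP (patternInverse p hp) ↔
      (∀ i x y, directImage (p i) (hp i) x ⊓ directImage (p i) (hp i) y ≤
        directImage (p i) (hp i) (x ⊓ y)) ∧
      ∀ i j, i ≠ j → directImage (p i) (hp i) ⊤ ⊓ directImage (p j) (hp j) ⊤ = ⊥ := by
  have hF : inFSpcP (patternInverse p hp) ↔ ∀ X Y : ∀ i, U i,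
      ⨆ i, directImage (p i) (hp i) (X i ⊓ Y i) =
        (⨆ i, directImage (p i) (hp i) (X i)) ⊓ ⨆ i, directImage (p i) (hp i) (Y i) := Iff.rfl
  rw [hF]
  constructor
  · intro H
    -- The open `x` of the summand `U i`, extended by `⊥` to the other summands.
    let s : ∀ i, U i → ∀ k, U k := fun i x => Function.update ⊥ i x
    have hs : ∀ i x, ⨆ k, directImage (p k) (hp k) (s i x k) = directImage (p i) (hp i) x := by
      intro i x
      refine le_antisymm (iSup_le fun k => ?_) (le_iSup_of_le i ?_)
      · by_cases hk : k = i
        · subst hk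
          simp only [s, Function.update_self, le_refl]
        · simp only [s, Function.update_of_ne hk, Pi.bot_apply, directImage_bot, bot_le]
      · simp only [s, Function.update_self, le_refl]
    refine ⟨fun i x y => ?_, fun i j hij => ?_⟩
    · rw [← hs i x, ← hs i y, ← H, ← hs i (x ⊓ y)]
      refine iSup_mono fun k => directImage_mono _ _ ?_
      by_cases hk : k = i
      · subst hk
        simp only [s, Function.update_self, le_refl]
      · simp only [s, Function.update_of_ne hk, Pi.bot_apply, inf_idem, le_refl]
    · rw [← hs i ⊤, ← hs j ⊤, ← H]
      refine iSup_eq_bot.2 fun k => ?_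
      by_cases hk : k = i
      · have hk' : k ≠ j := fun h => hij (hk.symm.trans h)
        simp only [s, Function.update_of_ne hk', Pi.bot_apply, inf_bot_eq, directImage_bot]
      · simp only [s, Function.update_of_ne hk, Pi.bot_apply, bot_inf_eq, directImage_bot]
  · rintro ⟨h1, h2⟩ X Y
    refine le_antisymm (le_inf ?_ ?_) ?_
    · exact iSup_mono fun i => directImage_mono _ _ inf_le_left
    · exact iSup_mono fun i => directImage_mono _ _ inf_le_right
    · simp only [iSup_inf_eq, inf_iSup_eq]
      refine iSup_le fun j => iSup_le fun i => ?_
      by_cases hij : i = j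
      · subst hij
        exact (h1 i _ _).trans (le_iSup (fun i => directImage (p i) (hp i) (X i ⊓ Y i)) i)
      · refine le_trans ?_ ((h2 i j hij).le.trans bot_le)
        exact inf_le_inf (directImage_mono _ _ le_top) (directImage_mono _ _ le_top)

theorem isPatternFamily_inFSpc_iff :
    IsPatternFamily inFSpc p ↔ IsPatternFamily inFSpcND p ∧ IsPatternFamily inFSpcP p :=
  ⟨fun ⟨hp, h1, h2⟩ => ⟨⟨hp, h1⟩, hp, h2⟩, fun ⟨⟨hp, h1⟩, _, h2⟩ => ⟨hp, h1, h2⟩⟩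

end PatternFamilies

/-! ### The four pretopologies -/

theorem isGrothendieckPretopology_ndp :
    IsGrothendieckPretopology (S := Locale.{u}) (fun {_ _ _} p => IsPatternFamily inFSpcNDP p) where
  iso_covers p hp := ⟨fun i => have := hp i; isOpenLocaleMap_of_isIso (p i), trivial⟩
  hasPullback p _ _ f i := hasPullback_locale (p i) f
  stable _ := fun ⟨hp, _⟩ _ _ _ _ _ sq => ⟨fun i => (hp i).of_isPullback (sq i), trivial⟩
  transitive _ := fun ⟨hp, _⟩ _ _ _ hq => ⟨fun x => ((hq x.1).1 x.2).comp (hp x.1), trivial⟩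

theorem isGrothendieckPretopology_nd :
    IsGrothendieckPretopology (S := Locale.{u}) (fun {_ _ _} p => IsPatternFamily inFSpcND p) where
  iso_covers {A I _ U} p hp := by
    have ho : ∀ i, IsOpenLocaleMap (p i) := fun i => have := hp i; isOpenLocaleMap_of_isIso (p i)
    refine ⟨ho, (inFSpcND_patternInverse_iff ho).2 (top_unique (le_iSup_of_le default ?_))⟩
    have := hp default
    rw [directImage_of_isIso, map_top]
  hasPullback p _ _ f i := hasPullback_locale (p i) f
  stable p := by
    rintro ⟨hp, h⟩ V f W g q sq
    have hq := fun i => (hp i).of_isPullback (sq i)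
    refine ⟨hq, (inFSpcND_patternInverse_iff hq).2 ?_⟩
    simp only [fun i => directImage_top_of_isPullback (sq i) (hp i) (hq i)]
    rw [← map_iSup, (inFSpcND_patternInverse_iff hp).1 h, map_top]
  transitive p := by
    rintro ⟨hp, h⟩ K W q hq
    choose ho hq using hq
    have hc : ∀ x : (i : _) × K i, IsOpenLocaleMap (q x.1 x.2 ≫ p x.1) :=
      fun x => (ho x.1 x.2).comp (hp x.1)
    refine ⟨hc, (inFSpcND_patternInverse_iff hc).2 ?_⟩
    simp only [fun x : (i : _) × K i => directImage_comp (ho x.1 x.2) (hp x.1) (hc x)]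
    rw [iSup_sigma]
    simp only [← (gc_directImage _ (hp _)).l_iSup]
    simp only [fun i => (inFSpcND_patternInverse_iff (ho i)).1 (hq i)]
    exact (inFSpcND_patternInverse_iff hp).1 h

theorem isGrothendieckPretopology_p :
    IsGrothendieckPretopology (S := Locale.{u}) (fun {_ _ _} p => IsPatternFamily inFSpcP p) where
  iso_covers {A I _ U} p hp := by
    have ho : ∀ i, IsOpenLocaleMap (p i) := fun i => have := hp i; isOpenLocaleMap_of_isIso (p i)
    refine ⟨ho, (inFSpcP_patternInverse_iff ho).2 ⟨fun i x y => ?_, fun i j hij =>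
      absurd (Subsingleton.elim i j) hij⟩⟩
    have := hp i
    rw [directImage_of_isIso, map_inf]
  hasPullback p _ _ f i := hasPullback_locale (p i) f
  stable p := by
    rintro ⟨hp, h⟩ V f W g q sq
    have hq := fun i => (hp i).of_isPullback (sq i)
    obtain ⟨h1, h2⟩ := (inFSpcP_patternInverse_iff hp).1 h
    refine ⟨hq, (inFSpcP_patternInverse_iff hq).2 ⟨fun i =>
      directImage_inf_le_of_isPullback (sq i) (hp i) (hq i) (h1 i), fun i j hij => ?_⟩⟩
    rw [directImage_top_of_isPullback (sq i) (hp i), directImage_top_of_isPullback (sq j) (hp j),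
      ← map_inf, h2 i j hij, map_bot]
  transitive p := by
    rintro ⟨hp, h⟩ K W q hq
    choose ho hq using hq
    have hc : ∀ x : (i : _) × K i, IsOpenLocaleMap (q x.1 x.2 ≫ p x.1) :=
      fun x => (ho x.1 x.2).comp (hp x.1)
    obtain ⟨h1, h2⟩ := (inFSpcP_patternInverse_iff hp).1 h
    have h' := fun i => (inFSpcP_patternInverse_iff (ho i)).1 (hq i)
    refine ⟨hc, (inFSpcP_patternInverse_iff hc).2 ⟨?_, ?_⟩⟩
    · rintro ⟨i, k⟩ x y
      simp only [directImage_comp (ho i k) (hp i)]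
      exact (h1 i _ _).trans (directImage_mono _ _ ((h' i).1 k x y))
    · rintro ⟨i, k⟩ ⟨j, l⟩ hne
      simp only [directImage_comp (ho i k) (hp i), directImage_comp (ho j l) (hp j)]
      by_cases hij : i = j
      · subst hij
        have hkl : k ≠ l := fun h => hne (h ▸ rfl)
        refine bot_unique ((h1 i _ _).trans ?_)
        rw [(h' i).2 k l hkl, directImage_bot]
      · refine bot_unique (le_trans ?_ (h2 i j hij).le)
        exact inf_le_inf (directImage_mono _ _ le_top) (directImage_mono _ _ le_top)

theorem isGrothendieckPretopology_fSpc :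
    IsGrothendieckPretopology (S := Locale.{u}) (fun {_ _ _} p => IsPatternFamily inFSpc p) where
  iso_covers p hp := isPatternFamily_inFSpc_iff.2
    ⟨isGrothendieckPretopology_nd.iso_covers p hp, isGrothendieckPretopology_p.iso_covers p hp⟩
  hasPullback p _ _ f i := hasPullback_locale (p i) f
  stable p h _ f _ g q sq :=
    have h := isPatternFamily_inFSpc_iff.1 h
    isPatternFamily_inFSpc_iff.2 ⟨isGrothendieckPretopology_nd.stable p h.1 f g q sq,
      isGrothendieckPretopology_p.stable p h.2 f g q sq⟩
  transitive p h _ _ q hq :=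
    have h := isPatternFamily_inFSpc_iff.1 h
    have hq := fun i => isPatternFamily_inFSpc_iff.1 (hq i)
    isPatternFamily_inFSpc_iff.2
      ⟨isGrothendieckPretopology_nd.transitive p h.1 q fun i => (hq i).1,
        isGrothendieckPretopology_p.transitive p h.2 q fun i => (hq i).2⟩

theorem mainTheorem2 :
    ∀ C ∈ ({inFSpc.{u}, inFSpcND.{u}, inFSpcP.{u}, inFSpcNDP.{u}} :
        Set (MorphismProperty FSpcNDP.{u})),
      IsGrothendieckPretopology (S := Locale.{u}) (fun {_ _ _} p => IsPatternFamily C p) := by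
  rintro C (rfl | rfl | rfl | rfl)
  · exact isGrothendieckPretopology_fSpc
  · exact isGrothendieckPretopology_nd
  · exact isGrothendieckPretopology_p
  · exact isGrothendieckPretopology_ndp
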